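/- Write $\|x\|=\sum_{i=1}^N x_i$ for $x\in\mathbb{Z}_+^N$. A probability measure $\pi$ on $\mathbb{Z}_+^N$ has an exponential tail if $\sum_x \pi(x)e^{\theta\|x\|}<\infty$ for some $\theta>0$. (A) Let $X$ be a time-homogeneous Markov chain on $\mathbb{Z}_+^N$ with $t$-step transition probabilities $P^t(x,y)$, $t\in\mathbb{Z}_+$, such that: (i) $X$ is skip-free: there is a constant $b_0$ such that, for every initial condition, almost surely $-b_0\le \|X(t+1)\|-\|X(t)\|\le b_0$ for all $t\ge 0$; (ii) $X$ is $0$-irreducible: $\sum_{t} P^t(x,0)>0$ for each $x$; (iii) $X$ is geometrically ergodic: there is an invariant probability measure $\pi$, and for some $\theta>0$ and all $x,y$, $\lim_{t\to\infty}e^{\theta t}|P^t(x,y)-\pi(y)|=0$. Then every invariant probability measure of $X$ (that is, $\pi$) has an exponential tail. (B) Consider a Markovian open multiclass queueing network with $N$ classes and $J$ servers. Each class $i$ has its own buffer, is served by exactly one server, and has independent Poisson arrivals of rate $\lambda_i\in[0,\infty)$ and exponential services of rate $\mu_i\in(0,\infty]$; $\mu_i=\infty$ means that services take no time. After service in buffer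 $i$ a job moves to a fixed buffer $i_+$, or leaves the network, in which case $i$ is called an exit buffer; the routing matrix $R$ ($R_{ij}=1$ if $j=i_+$, and $R_{ij}=0$ otherwise) satisfies $R^N=0$. The network is controlled by a stationary, possibly randomized, policy: while the vector of queue lengths is $x$, buffer $i$ with $\mu_i<\infty$ receives the (mean) fraction $\phi_i(x)\ge 0$ of the effort of its server, with $\phi_i(x)=0$ if $x_i=0$ and with fractions adding up to at most one at each server, so that services are completed in buffer $i$ at rate $\mu_i\phi_i(x)$; and for each $i$ with $\mu_i=\infty$ there is a set $\Xi_i\subset\mathbb{Z}_+^N$ of states at which the whole content of buffer $i$ is (or, for a randomized policy, may be) moved instantaneously to buffer $i_+$. Such drainings, possibly several in succession, take place at time $0$ or right after an arrival, a service completion, or a virtual service completion (virtual completions occur at rate $\mu_i(1-\phi_i(x))$ when $\mu_i<\infty$); the law of the state after them depends only on the initial state at time $0$, and afterwards only on the event and on the state just before it. Let $Q$ be the resulting right-continuous Markov jump process on $\mathbb{Z}_+^N$, with transition semigroup $P^t(x,y)=\mathbb{P}(Q(t)=y\mid Q(0)=x)$, $t\in[0,\infty)$, where $Q(0)=x$ refers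 to the state before the drainings at time $0$. Suppose that $\mu_i<\infty$ for each exit buffer $i$, and that $Q$ is exponentially ergodic: there is a probability measure $\pi$ with $\pi P^t=\pi$ for all $t\ge 0$, and for some $\theta>0$ and all $x,y$, $\lim_{t\to\infty}e^{\theta t}|P^t(x,y)-\pi(y)|=0$. Then every invariant probability measure of $Q$ (that is, $\pi$) has an exponential tail. -/

import Mathlib

open Filter Topology
open scoped NNReal ENNReal

/-! Markov chains on the lattice `ℤ₊^N`, given by their transition probabilities. -/

/-- The state space `ℤ₊^N`. -/
abbrev State (N : ℕ) : Type := Fin N → ℕ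

/-- The `L₁`-norm of a lattice point. -/
def l1 {N : ℕ} (x : State N) : ℕ := ∑ i, x i

/-- The `t`-step transition law `P^t(x, ·)` of the chain with one-step law `P(x, ·)`. -/
noncomputable def stepLaw {α : Type*} (P : α → PMF α) : ℕ → α → PMF α
  | 0, x => PMF.pure x
  | t + 1, x => (stepLaw P t x).bind P

/-- `π` has an exponential tail: `∑ π(x) e^{θ‖x‖} < ∞` for some `θ > 0`. -/
def HasExponentialTail {N : ℕ} (π : PMF (State N)) : Prop :=
  ∃ θ : ℝ, 0 < θ ∧ Summable fun x : State N => (π x).toReal * Real.exp (θ * (l1 x : ℝ))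

/-- From every state, the norm changes by at most a constant in one step, almost surely. -/
def IsSkipFree {N : ℕ} (P : State N → PMF (State N)) : Prop :=
  ∃ b₀ : ℝ, ∀ x, ∀ y ∈ (P x).support,
    -b₀ ≤ (l1 y : ℝ) - (l1 x : ℝ) ∧ (l1 y : ℝ) - (l1 x : ℝ) ≤ b₀

/-- `0`-irreducibility: `∑_t P^t(x, 0) > 0` for each `x`. -/
def IsZeroIrreducible {N : ℕ} (P : State N → PMF (State N)) : Prop :=
  ∀ x, 0 < ∑' t : ℕ, stepLaw P t x 0

/-- The probability `π` is invariant for the chain: `π(y) = ∑_x π(x) P(x, y)`. -/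
def IsInvariantLaw {α : Type*} (P : α → PMF α) (π : PMF α) : Prop :=
  π.bind P = π

/-- Geometric ergodicity: an invariant probability `π` exists, and for some `θ > 0` and each
`x, y`, `e^{θ t} |P^t(x, y) - π(y)| → 0` as `t → ∞` in `ℕ`. -/
def IsGeometricallyErgodic {α : Type*} (P : α → PMF α) : Prop :=
  ∃ π : PMF α, IsInvariantLaw P π ∧ ∃ θ : ℝ, 0 < θ ∧ ∀ x y,
    Tendsto (fun t : ℕ => Real.exp (θ * t) * |(stepLaw P t x y).toReal - (π y).toReal|)
      atTop (𝓝 0)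

/-- `π` is invariant for a continuous-time family of transition laws `P^t(x, ·)`. -/
def IsInvariantLawFlow {α : Type*} (P : ℝ≥0 → α → PMF α) (π : PMF α) : Prop :=
  ∀ t, π.bind (P t) = π

/-- Exponential ergodicity: an invariant probability `π` exists, and for some `θ > 0` and each
`x, y`, `e^{θ t} |P^t(x, y) - π(y)| → 0` as `t → ∞` in `[0, ∞)`. -/
def IsExponentiallyErgodic {α : Type*} (P : ℝ≥0 → α → PMF α) : Prop :=
  ∃ π : PMF α, IsInvariantLawFlow P π ∧ ∃ θ : ℝ, 0 < θ ∧ ∀ x y,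
    Tendsto (fun t : ℝ≥0 => Real.exp (θ * (t : ℝ)) * |(P t x y).toReal - (π y).toReal|)
      atTop (𝓝 0)

/-! Markovian multiclass queueing networks. -/

/-- A Markovian multiclass network with `N` classes (buffers) and `J` servers. -/
structure Network (N J : ℕ) where
  /-- the server of each class -/
  station : Fin N → Fin J
  /-- the buffer `i₊` to which a job goes after service in buffer `i`; `none` at exit buffers -/
  next : Fin N → Option (Fin N)
  /-- Poisson rates of the exogenous arrivals -/
  arrivalRate : Fin N → ℝ≥0
  /-- rates of the exponential service times; `∞` means that services take no time -/
  serviceRate : Fin N → ℝ≥0∞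
  serviceRate_pos : ∀ i, 0 < serviceRate i
  /-- the network is open: the routing matrix is nilpotent -/
  routing_pow : (Matrix.of fun i j : Fin N => if next i = some j then (1 : ℕ) else 0) ^ N = 0

namespace Network

variable {N J : ℕ}

/-- Move `k` jobs out of buffer `i`: to buffer `i₊`, or out of the network if `i` is an exit
buffer. It is used only for `k ≤ x i`. -/
def transfer (net : Network N J) (i : Fin N) (k : ℕ) (x : State N) : State N :=
  fun j => x j - (if j = i then k else 0) + (if net.next i = some j then k else 0)

/-- `y` arises from `x` by draining instantaneously, one after the other, finitely many
(possibly no) buffers with infinite service rate, where buffer `i` is drained only at states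
in `Ξ i`. -/
def DrainsTo (net : Network N J) (Ξ : Fin N → Set (State N)) : State N → State N → Prop :=
  Relation.ReflTransGen fun x y =>
    ∃ i, net.serviceRate i = ∞ ∧ x ∈ Ξ i ∧ y = net.transfer i (x i) x

end Network

/-- The ringing of one of the independent Poisson clocks that drive a network. -/
inductive NetworkEvent (N : ℕ) : Type
  /-- an exogenous arrival to buffer `i` -/
  | arrival (i : Fin N)
  /-- a (real) service completion at buffer `i` -/
  | completion (i : Fin N)
  /-- a virtual service completion: the service clock of buffer `i` rings without effect -/
  | virtual (i : Fin N)

/-- The state right after an event at state `x`, before instantaneous draining. -/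
def NetworkEvent.effect {N J : ℕ} (net : Network N J) (x : State N) : NetworkEvent N → State N
  | .arrival i => x + Pi.single i 1
  | .completion i => net.transfer i 1 x
  | .virtual _ => x

/-- The event is possible at `x`: a service can be completed only at a nonempty buffer. -/
def NetworkEvent.Possible {N : ℕ} (x : State N) : NetworkEvent N → Prop
  | .arrival _ => True
  | .completion i => 0 < x i
  | .virtual _ => True

/-- A stationary, possibly randomized, scheduling policy. -/
structure StationaryPolicy {N J : ℕ} (net : Network N J) where
  /-- the (mean) fraction of its effort that the server of buffer `i` gives to that buffer while
  the queue length vector is `x` -/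
  alloc : State N → Fin N → ℝ
  alloc_nonneg : ∀ x i, 0 ≤ alloc x i
  alloc_empty : ∀ x i, x i = 0 → alloc x i = 0
  /-- services of length zero take no effort -/
  alloc_top : ∀ x i, net.serviceRate i = ∞ → alloc x i = 0
  /-- servers have unit speed -/
  alloc_le : ∀ x j, ∑ i with net.station i = j, alloc x i ≤ 1
  /-- the states at which buffer `i`, if its service rate is infinite, is (or may be) drained -/
  drainSet : Fin N → Set (State N)
  /-- the states in which the process can stay for a positive time -/
  rest : Set (State N)
  /-- the law of the state after the instantaneous draining, if any, at time `0` -/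
  start : State N → PMF (State N)
  start_rest : ∀ x ∈ rest, start x = PMF.pure x
  start_support : ∀ x, ∀ y ∈ (start x).support, y ∈ rest ∧ net.DrainsTo drainSet x y
  /-- the law of the state after an event at `x` and the instantaneous draining, if any, that
  this event triggers -/
  jump : NetworkEvent N → State N → PMF (State N)
  jump_support : ∀ e, ∀ x ∈ rest, e.Possible x → ∀ y ∈ (jump e x).support,
    y ∈ rest ∧ net.DrainsTo drainSet (e.effect net x) y

namespace StationaryPolicy

variable {N J : ℕ} {net : Network N J}

/-- The rate at which an event occurs while the queue length vector is `x`. A buffer with infinite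
service rate has no service clock: its `toReal` rate is `0`. -/
noncomputable def eventRate (pol : StationaryPolicy net) (x : State N) : NetworkEvent N → ℝ
  | .arrival i => (net.arrivalRate i : ℝ)
  | .completion i => (net.serviceRate i).toReal * pol.alloc x i
  | .virtual i => (net.serviceRate i).toReal * (1 - pol.alloc x i)

/-- The contribution of an event to the `(x, y)` entry of the rate matrix. -/
noncomputable def eventGen (pol : StationaryPolicy net) (x y : State N) (e : NetworkEvent N) : ℝ :=
  pol.eventRate x e * ((pol.jump e x y).toReal - if x = y then 1 else 0)

/-- The rate matrix (generator) of the queue length process. -/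
noncomputable def generator (pol : StationaryPolicy net) (x y : State N) : ℝ :=
  ∑ i : Fin N, (pol.eventGen x y (.arrival i) + pol.eventGen x y (.completion i)
    + pol.eventGen x y (.virtual i))

/-- `P^t(x, ·)` is the law of `Q(t)` given `Q(0) = x`, for the right-continuous queue length
process `Q` of the network under the policy: the Markov jump process on the rest states with
the above rate matrix, which starts after the draining at time `0`. -/
structure IsTransitionSemigroup (pol : StationaryPolicy net)
    (P : ℝ≥0 → State N → PMF (State N)) : Prop where
  zero : ∀ x, P 0 x = pol.start x
  add : ∀ s t x, P (s + t) x = (P s x).bind (P t)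
  rates : ∀ x ∈ pol.rest, ∀ y,
    Tendsto (fun t : ℝ≥0 => ((P t x y).toReal - if x = y then 1 else 0) / (t : ℝ))
      (𝓝[>] 0) (𝓝 (pol.generator x y))

end StationaryPolicy

/-! Both halves rest on one principle, `hasExponentialTail_of_moment_growth`. Fix a state `a` with
`π a > 0` and let τ be its return time. Geometric convergence of `P^n(a,a)` to `π a` forces τ to
have a geometric tail: the probabilities `g n` of no return up to time `n` solve the renewal
equation `∑ u (n - s) * g s = 1` with `u n = P^n(a,a)`, and `geometric_decay_of_renewal` extracts
the decay by elementary means.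

Splitting the law at time `n` at the last visit to `a` bounds the mean of `e^{θ'‖·‖}` under
`P^n(a,·)`, uniformly in `n`, by its sum along one excursion. At step `n` of the excursion the
remaining mass is at most `D γ^n`, while a moment with a fixed exponent `η` has grown at most like
`K^n`. Interpolating between these bounds makes the excursion sum finite once `θ'` is small, and the
bound passes to `π` in the limit.

What remains is the growth of a moment. For a skip-free chain the norm grows at most linearly along
every path. For a network only arrivals increase the norm, so the generator `𝒢` satisfies `𝒢f ≤ c f`
for `f = min (e^{‖·‖}) M` with `c` independent of `M`. Grönwall's inequality
(`expectation_le_exp_mul`) then gives growth at most `e^{ct}`, and the principle is applied to the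
process at integer times. -/

/-! ### Geometric decay in renewal equations. -/

/-- A renewal equation whose renewal sequence converges geometrically to a positive limit
has a geometrically decaying solution. -/
theorem geometric_decay_of_renewal {u g : ℕ → ℝ} {p C ρ : ℝ} (hp : 0 < p) (hC : 0 < C)
    (hρ0 : 0 < ρ) (hρ1 : ρ < 1) (hu : ∀ n, |u n - p| ≤ C * ρ ^ n) (hg0 : ∀ n, 0 ≤ g n)
    (hg1 : ∀ n, g n ≤ 1) (hren : ∀ n, ∑ s ∈ Finset.range (n + 1), u (n - s) * g s = 1) :
    ∃ D γ : ℝ, 0 < D ∧ 0 < γ ∧ γ < 1 ∧ ∀ n, g n ≤ D * γ ^ n := by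
  set Y : ℕ → ℝ := fun n => ∑ s ∈ Finset.range (n + 1), ρ ^ (n - s) * g s with hY
  set S : ℕ → ℝ := fun n => ∑ s ∈ Finset.range (n + 1), g s with hS
  have hY0 : ∀ n, 0 ≤ Y n := fun n =>
    Finset.sum_nonneg fun s _ => mul_nonneg (pow_nonneg hρ0.le _) (hg0 s)
  have hYsucc : ∀ n, Y (n + 1) = ρ * Y n + g (n + 1) := by
    intro n
    simp only [hY]
    rw [Finset.sum_range_succ _ (n + 1), Finset.mul_sum]
    congr 1
    · refine Finset.sum_congr rfl fun s hs => ?_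
      have hs' : s ≤ n := Nat.lt_succ_iff.1 (Finset.mem_range.1 hs)
      rw [Nat.succ_sub hs', pow_succ]
      ring
    · simp
  have hSsucc : ∀ n, S (n + 1) = S n + g (n + 1) := fun n => Finset.sum_range_succ _ _
  -- Replacing `u` by its limit `p` in the renewal equation costs at most `C * Y n`. As `Y` is
  -- bounded, so is `S`; hence `g` and then `Y` are summable, and the error tends to zero.
  have hSY : ∀ n, |p * S n - 1| ≤ C * Y n := by
    intro n
    have h : p * S n - 1 = -∑ s ∈ Finset.range (n + 1), (u (n - s) - p) * g s := by
      rw [← hren n]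
      simp only [hS, sub_mul, Finset.sum_sub_distrib, Finset.mul_sum]
      ring
    rw [h, abs_neg]
    refine (Finset.abs_sum_le_sum_abs _ _).trans ?_
    simp only [hY, Finset.mul_sum]
    refine Finset.sum_le_sum fun s _ => ?_
    rw [abs_mul, abs_of_nonneg (hg0 s), ← mul_assoc]
    exact mul_le_mul_of_nonneg_right (hu _) (hg0 s)
  have hYb : ∀ n, Y n ≤ 1 / (1 - ρ) := by
    have h1 : 0 < 1 - ρ := by linarith
    intro n
    rw [le_div_iff₀ h1]
    induction n with
    | zero =>
      have := hg1 0
      have := hg0 0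
      simp only [hY, zero_add, Finset.range_one, Finset.sum_singleton, Nat.sub_zero, pow_zero,
        one_mul]
      nlinarith
    | succ n ih =>
      rw [hYsucc]
      have := hg1 (n + 1)
      nlinarith
  have hSb : ∀ n, S n ≤ (1 + C * (1 / (1 - ρ))) / p := by
    intro n
    rw [le_div_iff₀ hp]
    have h1 := (abs_le.1 (hSY n)).2
    have h2 := mul_le_mul_of_nonneg_left (hYb n) hC.le
    linarith
  have hgs : Summable g := by
    refine summable_of_sum_range_le (c := (1 + C * (1 / (1 - ρ))) / p) hg0 fun n => ?_
    refine le_trans ?_ (hSb n)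
    simp only [hS]
    rw [Finset.sum_range_succ]
    linarith [hg0 n]
  have hSle : ∀ n, S n ≤ ∑' s, g s := fun n => hgs.sum_le_tsum _ fun s _ => hg0 s
  have hYsum : ∀ m, (1 - ρ) * ∑ n ∈ Finset.range (m + 1), Y n + ρ * Y m = S m := by
    intro m
    induction m with
    | zero => simp [hY, hS]; ring
    | succ m ih =>
      rw [Finset.sum_range_succ, hSsucc, ← ih, hYsucc]
      ring
  have hYs : Summable Y := by
    refine summable_of_sum_range_le (c := (∑' s, g s) / (1 - ρ)) hY0 fun n => ?_
    have h1 : 0 < 1 - ρ := by linarith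
    rw [le_div_iff₀ h1]
    have h2 := hYsum n
    rw [Finset.sum_range_succ] at h2
    have h3 := mul_nonneg hρ0.le (hY0 n)
    have h4 := mul_nonneg h1.le (hY0 n)
    linarith [hSle n]
  have hSt : Tendsto S atTop (𝓝 (∑' s, g s)) :=
    hgs.hasSum.tendsto_sum_nat.comp (tendsto_add_atTop_nat 1)
  have hle1 : p * ∑' s, g s ≤ 1 := by
    have h1 : Tendsto (fun n => p * S n - C * Y n) atTop (𝓝 (p * (∑' s, g s) - C * 0)) :=
      (hSt.const_mul p).sub (hYs.tendsto_atTop_zero.const_mul C)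
    rw [mul_zero, sub_zero] at h1
    exact le_of_tendsto' h1 fun n => by linarith [(abs_le.1 (hSY n)).2]
  set T : ℕ → ℝ := fun n => (∑' s, g s) - S n with hT
  have hT0 : ∀ n, 0 ≤ T n := fun n => sub_nonneg.2 (hSle n)
  have hTY : ∀ n, p * T n ≤ C * Y n := by
    intro n
    have := (abs_le.1 (hSY n)).1
    simp only [hT, mul_sub]
    linarith
  -- One step sends `Y + T` to `ρ * Y + T`, which shrinks only the `Y` part. Since `p * T ≤ C * Y`,
  -- that part is a fixed share of the whole; `γ` solves `(1 - γ) * C = p * (γ - ρ)`, the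
  -- contraction factor in the worst case.
  set γ : ℝ := (C + p * ρ) / (C + p) with hγ
  have hCp : 0 < C + p := by linarith
  have hγ0 : 0 < γ := by positivity
  have hγ1 : γ < 1 := by
    rw [hγ, div_lt_one hCp]
    nlinarith
  have hγe : γ * (C + p) = C + p * ρ := by rw [hγ]; field_simp
  have hZ : ∀ n, Y n + T n ≤ (Y 0 + T 0) * γ ^ n := by
    intro n
    induction n with
    | zero => simp
    | succ n ih =>
      have h1 : Y (n + 1) + T (n + 1) = ρ * Y n + T n := by
        simp only [hT]
        rw [hYsucc, hSsucc]
        ring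
      rw [h1, pow_succ, ← mul_assoc]
      refine le_trans ?_ (mul_le_mul_of_nonneg_right ih hγ0.le)
      have h2 : (1 - γ) * (p * T n) ≤ (1 - γ) * (C * Y n) :=
        mul_le_mul_of_nonneg_left (hTY n) (by linarith)
      have h3 : (1 - γ) * C = p * (γ - ρ) := by linarith
      have h4 : p * ((1 - γ) * T n) ≤ p * ((γ - ρ) * Y n) := by
        calc p * ((1 - γ) * T n) = (1 - γ) * (p * T n) := by ring
          _ ≤ (1 - γ) * (C * Y n) := h2
          _ = ((1 - γ) * C) * Y n := by ring
          _ = p * ((γ - ρ) * Y n) := by rw [h3]; ring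
      have h5 := le_of_mul_le_mul_left h4 hp
      linarith
  have hgY : ∀ n, g n ≤ Y n := by
    intro n
    cases n with
    | zero => simp [hY]
    | succ n =>
      rw [hYsucc]
      have := mul_nonneg hρ0.le (hY0 n)
      linarith
  refine ⟨Y 0 + T 0 + 1, γ, by linarith [hY0 0, hT0 0], hγ0, hγ1, fun n => ?_⟩
  have := pow_nonneg hγ0.le n
  have := hZ n
  have := hgY n
  have := hT0 n
  linarith

/-! ### Last-visit decomposition and the tail of the return time. -/

section Taboo

variable {α : Type*} (P : α → PMF α) (a : α)

open Classical in
/-- The probability that the chain started at `a` is at `y` at time `n`, without having returned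
to `a` at the times `1, …, n`. -/
noncomputable def taboo : ℕ → α → ℝ≥0∞
  | 0, y => if y = a then 1 else 0
  | n + 1, y => if y = a then 0 else ∑' x, taboo n x * P x y

/-- Decomposition of the law at time `n` according to the last visit to `a`. -/
theorem stepLaw_eq_sum_taboo (n : ℕ) (y : α) :
    stepLaw P n a y = ∑ s ∈ Finset.range (n + 1), stepLaw P (n - s) a a * taboo P a s y := by
  classical
  induction n generalizing y with
  | zero => simp [stepLaw, taboo, PMF.pure_apply]
  | succ n ih =>
    rw [Finset.sum_range_succ']
    -- At `a` only the term `s = 0` survives. Elsewhere that term vanishes, and the others come from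
    -- one step of the chain after time `n`.
    by_cases hy : y = a
    · subst hy
      simp [taboo]
    · simp only [taboo, hy, if_false, mul_zero, add_zero, Nat.add_sub_add_right]
      rw [stepLaw, PMF.bind_apply]
      simp_rw [ih, Finset.sum_mul, mul_assoc]
      rw [Summable.tsum_finsetSum fun _ _ => ENNReal.summable]
      simp_rw [ENNReal.tsum_mul_left]

theorem taboo_le_stepLaw (n : ℕ) (y : α) : taboo P a n y ≤ stepLaw P n a y := by
  rw [stepLaw_eq_sum_taboo]
  refine le_trans ?_ (Finset.single_le_sum (f := fun s => stepLaw P (n - s) a a * taboo P a s y)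
    (fun _ _ => zero_le) (Finset.self_mem_range_succ n))
  simp [stepLaw]

theorem tsum_taboo_le_one (n : ℕ) : ∑' y, taboo P a n y ≤ 1 :=
  (ENNReal.tsum_le_tsum fun y => taboo_le_stepLaw P a n y).trans (PMF.tsum_coe _).le

/-- The renewal equation: the last-visit decomposition summed over the final state. The total taboo
mass at time `s` is the probability of no return up to `s`. -/
theorem sum_stepLaw_mul_tsum_taboo (n : ℕ) :
    ∑ s ∈ Finset.range (n + 1), stepLaw P (n - s) a a * ∑' y, taboo P a s y = 1 := by
  rw [← PMF.tsum_coe (stepLaw P n a)]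
  simp_rw [stepLaw_eq_sum_taboo P a n]
  rw [Summable.tsum_finsetSum fun _ _ => ENNReal.summable]
  simp_rw [ENNReal.tsum_mul_left]

/-- Geometric convergence of the return probabilities makes the return time have a geometric
tail. -/
theorem exists_tsum_taboo_le {p θ : ℝ} (hp : 0 < p) (hθ : 0 < θ)
    (h : Tendsto (fun t : ℕ => Real.exp (θ * t) * |(stepLaw P t a a).toReal - p|) atTop (𝓝 0)) :
    ∃ D γ : ℝ, 0 < D ∧ 0 < γ ∧ γ < 1 ∧ ∀ n, ∑' y, taboo P a n y ≤ ENNReal.ofReal (D * γ ^ n) := by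
  obtain ⟨C, hC⟩ := h.bddAbove_range
  have htop : ∀ n, ∑' y, taboo P a n y ≠ ∞ := fun n =>
    ((tsum_taboo_le_one P a n).trans_lt ENNReal.one_lt_top).ne
  have hdecay : ∀ n, |(stepLaw P n a a).toReal - p| ≤ max C 1 * Real.exp (-θ) ^ n := by
    intro n
    have h1 : Real.exp (θ * n) * |(stepLaw P n a a).toReal - p| ≤ max C 1 :=
      (hC ⟨n, rfl⟩).trans (le_max_left _ _)
    have h2 : Real.exp (-θ) ^ n = (Real.exp (θ * n))⁻¹ := by
      rw [← Real.exp_nat_mul, ← Real.exp_neg]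
      ring_nf
    rw [h2, ← div_eq_mul_inv, le_div_iff₀ (Real.exp_pos _)]
    linarith
  obtain ⟨D, γ, hD, h0, h1, hg⟩ := geometric_decay_of_renewal
    (u := fun n => (stepLaw P n a a).toReal) (g := fun n => (∑' y, taboo P a n y).toReal) hp
    (lt_max_of_lt_right one_pos) (Real.exp_pos (-θ)) (Real.exp_lt_one_iff.2 (by linarith)) hdecay
    (fun _ => ENNReal.toReal_nonneg)
    (fun n => ENNReal.toReal_le_of_le_ofReal zero_le_one (by simpa using tsum_taboo_le_one P a n))
    (fun n => by
      rw [← ENNReal.toReal_one, ← sum_stepLaw_mul_tsum_taboo P a n, ENNReal.toReal_sum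
        fun s _ => ENNReal.mul_ne_top (PMF.apply_ne_top _ _) (htop s)]
      simp_rw [ENNReal.toReal_mul])
  refine ⟨D, γ, hD, h0, h1, fun n => ?_⟩
  rw [← ENNReal.ofReal_toReal (htop n)]
  exact ENNReal.ofReal_le_ofReal (hg n)

end Taboo

/-! ### From moment growth to exponential tails. -/

/-- A cutoff at level `l`. With `l = β ^ n` it splits a small exponential moment into a part
controlled by the mass and a part controlled by a higher moment. -/
theorem le_add_pow_succ_div_pow {v l : ℝ} (hv : 0 ≤ v) (hl : 0 < l) (k : ℕ) :
    v ≤ l + v ^ (k + 1) / l ^ k := by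
  rcases le_total v l with h | h
  · have : 0 ≤ v ^ (k + 1) / l ^ k := by positivity
    linarith
  · have : v ≤ v ^ (k + 1) / l ^ k := by
      rw [le_div_iff₀ (by positivity), pow_succ']
      exact mul_le_mul_of_nonneg_left (pow_le_pow_left₀ hl.le h k) hv
    linarith

theorem tendsto_of_tendsto_exp_mul {ι : Type*} {l : Filter ι} {f c : ι → ℝ} {p θ : ℝ}
    (hθ : 0 ≤ θ) (hc : ∀ t, 0 ≤ c t)
    (h : Tendsto (fun t => Real.exp (θ * c t) * |f t - p|) l (𝓝 0)) : Tendsto f l (𝓝 p) := by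
  rw [tendsto_iff_dist_tendsto_zero]
  refine squeeze_zero (fun _ => dist_nonneg) (fun n => ?_) h
  rw [Real.dist_eq]
  exact le_mul_of_one_le_left (abs_nonneg _) (Real.one_le_exp (mul_nonneg hθ (hc n)))

/-- A chain that converges geometrically from a state `a` with `π a > 0`, and along which an
exponential moment grows at most geometrically, has an exponential tail in equilibrium. -/
theorem hasExponentialTail_of_moment_growth {N : ℕ} (P : State N → PMF (State N)) (a : State N)
    (π : PMF (State N)) (ha : π a ≠ 0) {θ : ℝ} (hθ : 0 < θ)
    (h : ∀ y, Tendsto (fun t : ℕ => Real.exp (θ * t) * |(stepLaw P t a y).toReal - (π y).toReal|)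
      atTop (𝓝 0))
    {η C K : ℝ} (hη : 0 < η) (hC : 0 ≤ C) (hK : 0 < K)
    (hmom : ∀ n, ∑' y, stepLaw P n a y * ENNReal.ofReal (Real.exp (η * (l1 y : ℝ)))
      ≤ ENNReal.ofReal (C * K ^ n)) :
    HasExponentialTail π := by
  obtain ⟨D, γ, hD, hγ0, hγ1, hg⟩ := exists_tsum_taboo_le P a
    (ENNReal.toReal_pos ha (PMF.apply_ne_top _ _)) hθ (h a)
  -- The cutoff `β ^ n` must grow slowly enough for the taboo mass `γ ^ n` to beat it, yet some
  -- power `β ^ k` must exceed the moment growth `K`.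
  obtain ⟨β, hβ1, hβ⟩ := exists_between ((one_lt_inv₀ hγ0).2 hγ1)
  have hβ0 : 0 < β := by linarith
  have hβγ : β * γ < 1 := by rwa [lt_inv_comm₀ hβ0 hγ0, ← one_div, lt_div_iff₀ hβ0,
    mul_comm] at hβ
  obtain ⟨k, hk⟩ := pow_unbounded_of_one_lt K hβ1
  have hk0 : 0 < β ^ k := by positivity
  -- Chosen so that the power `k + 1` of `v` is the moment with exponent `η`.
  set θ' : ℝ := η / (k + 1 : ℕ) with hθ'
  have hk1 : (0 : ℝ) < (k + 1 : ℕ) := by positivity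
  set v : State N → ℝ≥0∞ := fun y => ENNReal.ofReal (Real.exp (θ' * (l1 y : ℝ))) with hv
  have hv_le : ∀ n y, v y ≤ ENNReal.ofReal (β ^ n)
      + ENNReal.ofReal (Real.exp (η * (l1 y : ℝ))) * ENNReal.ofReal (((β ^ k) ^ n)⁻¹) := by
    intro n y
    rw [← ENNReal.ofReal_mul (Real.exp_pos _).le, ← ENNReal.ofReal_add (by positivity)
      (by positivity)]
    refine ENNReal.ofReal_le_ofReal ?_
    have h1 := le_add_pow_succ_div_pow (Real.exp_pos (θ' * (l1 y : ℝ))).le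
      (pow_pos hβ0 n) k
    rw [← Real.exp_nat_mul, ← pow_mul, mul_comm n k, pow_mul, div_eq_mul_inv] at h1
    convert h1 using 4
    rw [hθ', ← mul_assoc, mul_div_cancel₀ _ hk1.ne']
  set b : ℕ → ℝ≥0∞ := fun n => ∑' y, taboo P a n y * v y with hb
  have hb_le : ∀ n, b n ≤ ENNReal.ofReal (D * (β * γ) ^ n + C * (K / β ^ k) ^ n) := by
    intro n
    calc b n ≤ ∑' y, (taboo P a n y * ENNReal.ofReal (β ^ n) + stepLaw P n a y *
            ENNReal.ofReal (Real.exp (η * (l1 y : ℝ))) * ENNReal.ofReal (((β ^ k) ^ n)⁻¹)) := by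
          refine ENNReal.tsum_le_tsum fun y => ?_
          refine (mul_le_mul_right (hv_le n y) _).trans ?_
          rw [mul_add, ← mul_assoc]
          gcongr
          exact taboo_le_stepLaw P a n y
      _ = (∑' y, taboo P a n y) * ENNReal.ofReal (β ^ n) + (∑' y, stepLaw P n a y *
            ENNReal.ofReal (Real.exp (η * (l1 y : ℝ)))) * ENNReal.ofReal (((β ^ k) ^ n)⁻¹) := by
          rw [ENNReal.tsum_add, ENNReal.tsum_mul_right, ENNReal.tsum_mul_right]
      _ ≤ ENNReal.ofReal (D * γ ^ n) * ENNReal.ofReal (β ^ n)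
            + ENNReal.ofReal (C * K ^ n) * ENNReal.ofReal (((β ^ k) ^ n)⁻¹) := by
          gcongr
          · exact hg n
          · exact hmom n
      _ = ENNReal.ofReal (D * (β * γ) ^ n + C * (K / β ^ k) ^ n) := by
          rw [← ENNReal.ofReal_mul (by positivity), ← ENNReal.ofReal_mul (by positivity),
            ← ENNReal.ofReal_add (by positivity) (by positivity), mul_pow, div_pow]
          congr 1
          ring
  have hb_sum : ∑' n, b n ≠ ∞ := by
    have hs : Summable fun n : ℕ => D * (β * γ) ^ n + C * (K / β ^ k) ^ n :=
      ((summable_geometric_of_lt_one (by positivity) hβγ).mul_left D).add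
        ((summable_geometric_of_lt_one (by positivity) ((div_lt_one hk0).2 hk)).mul_left C)
    exact ne_top_of_le_ne_top hs.tsum_ofReal_ne_top (ENNReal.tsum_le_tsum hb_le)
  have hstep : ∀ n, ∑' y, stepLaw P n a y * v y ≤ ∑' n, b n := by
    intro n
    simp_rw [stepLaw_eq_sum_taboo P a n, Finset.sum_mul, mul_assoc]
    rw [Summable.tsum_finsetSum fun _ _ => ENNReal.summable]
    simp_rw [ENNReal.tsum_mul_left]
    refine le_trans (Finset.sum_le_sum fun s _ => ?_) (ENNReal.sum_le_tsum (Finset.range (n + 1)))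
    exact mul_le_of_le_one_left zero_le (PMF.coe_le_one _ _)
  have hlim : ∀ y, Tendsto (fun n => stepLaw P n a y) atTop (𝓝 (π y)) := by
    intro y
    rw [← ENNReal.tendsto_toReal_iff (fun _ => PMF.apply_ne_top _ _) (PMF.apply_ne_top _ _)]
    exact tendsto_of_tendsto_exp_mul hθ.le (fun t => Nat.cast_nonneg t) (h y)
  -- Fatou's lemma, by way of finite partial sums.
  have hπ : ∑' y, π y * v y ≤ ∑' n, b n := by
    rw [ENNReal.tsum_eq_iSup_sum]
    refine iSup_le fun F => ?_
    have hF : Tendsto (fun n => ∑ y ∈ F, stepLaw P n a y * v y) atTop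
        (𝓝 (∑ y ∈ F, π y * v y)) :=
      tendsto_finsetSum _ fun y _ =>
        ENNReal.Tendsto.mul_const (hlim y) (Or.inr ENNReal.ofReal_ne_top)
    exact le_of_tendsto' hF fun n => (ENNReal.sum_le_tsum F).trans (hstep n)
  refine ⟨θ', by positivity, ?_⟩
  have := ENNReal.summable_toReal (ne_top_of_le_ne_top hb_sum hπ)
  simpa [hv, ENNReal.toReal_mul, ENNReal.toReal_ofReal (Real.exp_pos _).le] using this

/-! ### Uniqueness of the invariant law, and skip-free chains. -/

/-- A law that is invariant under kernels which converge pointwise to `π` equals `π`. -/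
theorem eq_of_bind_eq_of_tendsto {α : Type*} (Q : ℕ → α → PMF α) (π π' : PMF α)
    (hinv : ∀ n, π'.bind (Q n) = π')
    (hlim : ∀ x y, Tendsto (fun n => (Q n x y).toReal) atTop (𝓝 (π y).toReal)) : π' = π := by
  have hs : Summable fun x => (π' x).toReal := ENNReal.summable_toReal π'.tsum_coe_ne_top
  have hs1 : ∑' x, (π' x).toReal = 1 := by
    rw [← ENNReal.tsum_toReal_eq fun x => PMF.apply_ne_top _ _, PMF.tsum_coe, ENNReal.toReal_one]
  ext y
  rw [← ENNReal.toReal_eq_toReal_iff' (PMF.apply_ne_top _ _) (PMF.apply_ne_top _ _)]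
  have h1 : ∀ n, (π' y).toReal = ∑' x, (π' x).toReal * (Q n x y).toReal := by
    intro n
    conv_lhs => rw [← hinv n, PMF.bind_apply]
    rw [ENNReal.tsum_toReal_eq fun x =>
      ENNReal.mul_ne_top (PMF.apply_ne_top _ _) (PMF.apply_ne_top _ _)]
    simp_rw [ENNReal.toReal_mul]
  have h2 : Tendsto (fun n => ∑' x, (π' x).toReal * (Q n x y).toReal) atTop
      (𝓝 (∑' x, (π' x).toReal * (π y).toReal)) := by
    refine tendsto_tsum_of_dominated_convergence hs (fun x => (hlim x y).const_mul _)
      (Eventually.of_forall fun n x => ?_)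
    rw [Real.norm_of_nonneg (by positivity)]
    refine mul_le_of_le_one_right ENNReal.toReal_nonneg ?_
    exact ENNReal.toReal_le_of_le_ofReal zero_le_one (by simpa using PMF.coe_le_one _ _)
  rw [tsum_mul_right, hs1, one_mul] at h2
  exact tendsto_nhds_unique (tendsto_const_nhds.congr h1) h2

theorem bind_stepLaw_of_isInvariantLaw {α : Type*} {P : α → PMF α} {π : PMF α}
    (h : IsInvariantLaw P π) (n : ℕ) : π.bind (stepLaw P n) = π := by
  induction n with
  | zero => exact PMF.bind_pure π
  | succ n ih =>
    have : stepLaw P (n + 1) = fun x => (stepLaw P n x).bind P := rfl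
    rw [this, ← PMF.bind_bind, ih]
    exact h

/-- Equilibria of skip-free geometrically ergodic chains have exponential tails. -/
theorem IsSkipFree.hasExponentialTail {N : ℕ} {P : State N → PMF (State N)} (hP : IsSkipFree P)
    (hE : IsGeometricallyErgodic P) {π : PMF (State N)} (hπ : IsInvariantLaw P π) :
    HasExponentialTail π := by
  obtain ⟨π₀, -, θ, hθ, h⟩ := hE
  obtain rfl : π = π₀ := eq_of_bind_eq_of_tendsto (stepLaw P) π₀ π
    (bind_stepLaw_of_isInvariantLaw hπ) fun x y =>
      tendsto_of_tendsto_exp_mul hθ.le (fun t => Nat.cast_nonneg t) (h x y)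
  obtain ⟨b, hb⟩ := hP
  obtain ⟨a, ha⟩ := π.support_nonempty
  have hbound : ∀ n, ∀ y ∈ (stepLaw P n a).support, (l1 y : ℝ) ≤ l1 a + b * n := by
    intro n
    induction n with
    | zero =>
      intro y hy
      simp only [stepLaw, PMF.support_pure, Set.mem_singleton_iff] at hy
      simp [hy]
    | succ n ih =>
      intro y hy
      obtain ⟨x, hx, hxy⟩ := (PMF.mem_support_bind_iff _ _ _).1 hy
      have h1 := ih x hx
      have h2 := (hb x y hxy).2
      push_cast
      linarith
  refine hasExponentialTail_of_moment_growth P a π ((PMF.mem_support_iff _ _).1 ha) hθ (h a)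
    one_pos (Real.exp_pos (l1 a)).le (Real.exp_pos b) fun n => ?_
  have hle : ∀ y, stepLaw P n a y * ENNReal.ofReal (Real.exp (1 * (l1 y : ℝ)))
      ≤ stepLaw P n a y * ENNReal.ofReal (Real.exp (l1 a) * Real.exp b ^ n) := by
    intro y
    by_cases hy : y ∈ (stepLaw P n a).support
    · refine mul_le_mul_right (ENNReal.ofReal_le_ofReal ?_) _
      rw [← Real.exp_nat_mul, ← Real.exp_add, Real.exp_le_exp]
      linarith [hbound n y hy]
    · rw [PMF.mem_support_iff, not_not] at hy
      simp [hy]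
  refine (ENNReal.tsum_le_tsum hle).trans ?_
  rw [ENNReal.tsum_mul_right, PMF.tsum_coe, one_mul]

/-! ### Expectations of bounded functions. -/

section Expectation

variable {α : Type*}

/-- The expectation of a real function. -/
noncomputable def expectation (p : PMF α) (f : α → ℝ) : ℝ := ∑' y, (p y).toReal * f y

theorem summable_toReal_mul (p : PMF α) {f : α → ℝ} {M : ℝ} (hf : ∀ y, |f y| ≤ M) :
    Summable fun y => (p y).toReal * f y := by
  refine Summable.of_norm_bounded ((ENNReal.summable_toReal p.tsum_coe_ne_top).mul_right M)
    fun y => ?_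
  rw [norm_mul, Real.norm_of_nonneg ENNReal.toReal_nonneg]
  exact mul_le_mul_of_nonneg_left (hf y) ENNReal.toReal_nonneg

theorem tsum_toReal_eq_one (p : PMF α) : ∑' y, (p y).toReal = 1 := by
  rw [← ENNReal.tsum_toReal_eq fun y => PMF.apply_ne_top _ _, PMF.tsum_coe, ENNReal.toReal_one]

theorem toReal_le_one (p : PMF α) (y : α) : (p y).toReal ≤ 1 :=
  ENNReal.toReal_le_of_le_ofReal zero_le_one (by simpa using PMF.coe_le_one _ _)

theorem expectation_nonneg (p : PMF α) {f : α → ℝ} (hf : ∀ y, 0 ≤ f y) : 0 ≤ expectation p f :=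
  tsum_nonneg fun y => mul_nonneg ENNReal.toReal_nonneg (hf y)

theorem expectation_pure (x : α) (f : α → ℝ) : expectation (PMF.pure x) f = f x := by
  classical
  rw [expectation, tsum_eq_single x]
  · simp
  · intro y hy
    simp [PMF.pure_apply, hy]

theorem expectation_le_of_support (p : PMF α) {f : α → ℝ} {M c : ℝ} (hf : ∀ y, |f y| ≤ M)
    (h : ∀ y ∈ p.support, f y ≤ c) : expectation p f ≤ c := by
  have hs : Summable fun y => (p y).toReal * c := summable_toReal_mul p fun _ => le_refl |c|
  calc expectation p f ≤ ∑' y, (p y).toReal * c := by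
        refine (summable_toReal_mul p hf).tsum_le_tsum (fun y => ?_) hs
        by_cases hy : y ∈ p.support
        · exact mul_le_mul_of_nonneg_left (h y hy) ENNReal.toReal_nonneg
        · rw [PMF.mem_support_iff, not_not] at hy
          simp [hy]
    _ = c := by rw [tsum_mul_right, tsum_toReal_eq_one, one_mul]

theorem ofReal_expectation (p : PMF α) {f : α → ℝ} {M : ℝ} (h0 : ∀ y, 0 ≤ f y)
    (hM : ∀ y, f y ≤ M) : ENNReal.ofReal (expectation p f) = ∑' y, p y * ENNReal.ofReal (f y) := by
  rw [expectation, ENNReal.ofReal_tsum_of_nonneg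
    (fun y => mul_nonneg ENNReal.toReal_nonneg (h0 y))
    (summable_toReal_mul p fun y => by rw [abs_of_nonneg (h0 y)]; exact hM y)]
  simp_rw [ENNReal.ofReal_mul ENNReal.toReal_nonneg, ENNReal.ofReal_toReal (PMF.apply_ne_top _ _)]

theorem expectation_le (p : PMF α) {f : α → ℝ} {M : ℝ} (h0 : ∀ y, 0 ≤ f y)
    (hM : ∀ y, f y ≤ M) : expectation p f ≤ M :=
  expectation_le_of_support p (fun y => by rw [abs_of_nonneg (h0 y)]; exact hM y) fun y _ => hM y

theorem expectation_bind (p : PMF α) (Q : α → PMF α) {f : α → ℝ} {M : ℝ} (h0 : ∀ y, 0 ≤ f y)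
    (hM : ∀ y, f y ≤ M) :
    expectation (p.bind Q) f = expectation p fun z => expectation (Q z) f := by
  have hE0 : ∀ z, 0 ≤ expectation (Q z) f := fun z => expectation_nonneg _ h0
  rw [← ENNReal.ofReal_eq_ofReal_iff (expectation_nonneg _ h0) (expectation_nonneg _ hE0),
    ofReal_expectation _ h0 hM, ofReal_expectation _ hE0 fun z => expectation_le _ h0 hM]
  simp_rw [ofReal_expectation _ h0 hM, PMF.bind_apply, ← ENNReal.tsum_mul_left,
    ← ENNReal.tsum_mul_right, mul_assoc]
  exact ENNReal.tsum_comm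

/-- Only the mass away from `z` contributes, and there two values in `[0, M]` are compared. -/
theorem abs_expectation_sub_le (p : PMF α) (z : α) {f : α → ℝ} {M : ℝ} (h0 : ∀ y, 0 ≤ f y)
    (hM : ∀ y, f y ≤ M) : |expectation p f - f z| ≤ M * (1 - (p z).toReal) := by
  classical
  have habs : ∀ y, |f y| ≤ M := fun y => by rw [abs_of_nonneg (h0 y)]; exact hM y
  have hs := summable_toReal_mul p habs
  have h1 : (p z).toReal * f z ≤ expectation p f :=
    hs.le_tsum z fun y _ => mul_nonneg ENNReal.toReal_nonneg (h0 y)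
  have h2 : expectation p f ≤ M + (p z).toReal * (f z - M) := by
    have hs1 : Summable fun y => (p y).toReal * M := summable_toReal_mul p fun _ => le_refl |M|
    have hs2 := (hasSum_ite_eq z ((p z).toReal * (f z - M)))
    calc expectation p f
        ≤ ∑' y, ((p y).toReal * M + if y = z then (p z).toReal * (f z - M) else 0) := by
          refine hs.tsum_le_tsum (fun y => ?_) (hs1.add hs2.summable)
          by_cases hy : y = z
          · subst hy
            simp only [if_true]
            linarith
          · simp only [hy, if_false, add_zero]
            exact mul_le_mul_of_nonneg_left (hM y) ENNReal.toReal_nonneg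
      _ = M + (p z).toReal * (f z - M) := by
          rw [hs1.tsum_add hs2.summable, tsum_mul_right, tsum_toReal_eq_one, one_mul, hs2.tsum_eq]
  have h3 := toReal_le_one p z
  have h4 : 0 ≤ (1 - (p z).toReal) * f z := mul_nonneg (by linarith) (h0 z)
  have h5 : 0 ≤ (1 - (p z).toReal) * (M - f z) := mul_nonneg (by linarith) (by linarith [hM z])
  rw [abs_le]
  constructor <;> linarith

end Expectation

/-! ### Jump semigroups with bounded rates: generator and Grönwall bound. -/

/-- A transition semigroup on `α`, concentrated on `S`, with rate matrix `q` on `S`, conservative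
and with exit rates at most `Λ`. -/
structure IsBoundedJumpSemigroup {α : Type*} (P : ℝ≥0 → α → PMF α) (S : Set α) (q : α → α → ℝ)
    (Λ : ℝ) : Prop where
  zero : ∀ x ∈ S, P 0 x = PMF.pure x
  add : ∀ s t x, P (s + t) x = (P s x).bind (P t)
  support_subset : ∀ t x, (P t x).support ⊆ S
  summable : ∀ x ∈ S, Summable (q x)
  conservative : ∀ x ∈ S, ∑' y, q x y = 0
  neg_diag_le : ∀ x ∈ S, -q x x ≤ Λ
  tendsto : ∀ x ∈ S, ∀ y, Tendsto
    (fun t : ℝ≥0 => ((P t x y).toReal - (PMF.pure x y).toReal) / (t : ℝ)) (𝓝[>] 0) (𝓝 (q x y))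

namespace IsBoundedJumpSemigroup

variable {α : Type*} {P : ℝ≥0 → α → PMF α} {S : Set α} {q : α → α → ℝ} {Λ : ℝ}

theorem pow_le_apply_self (h : IsBoundedJumpSemigroup P S q Λ) {x : α} (hx : x ∈ S) (s : ℝ≥0)
    (m : ℕ) : (P s x x).toReal ^ m ≤ (P (m * s) x x).toReal := by
  induction m with
  | zero => simp [h.zero x hx]
  | succ m ih =>
    have h1 : P (m * s) x x * P s x x ≤ P ((m + 1 : ℕ) * s) x x := by
      have : ((m + 1 : ℕ) : ℝ≥0) * s = m * s + s := by push_cast; ring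
      rw [this, h.add, PMF.bind_apply]
      exact ENNReal.le_tsum (f := fun z => P (m * s) x z * P s z x) x
    calc (P s x x).toReal ^ (m + 1) ≤ (P (m * s) x x).toReal * (P s x x).toReal := by
          rw [pow_succ]
          exact mul_le_mul_of_nonneg_right ih ENNReal.toReal_nonneg
      _ = (P (m * s) x x * P s x x).toReal := ENNReal.toReal_mul.symm
      _ ≤ _ := ENNReal.toReal_mono (PMF.apply_ne_top _ _) h1

/-- The probability of leaving a state within time `t` is at most linear in `t`, uniformly over
the states. -/
theorem one_sub_apply_self_le (h : IsBoundedJumpSemigroup P S q Λ) {x : α} (hx : x ∈ S)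
    (t : ℝ≥0) : 1 - (P t x x).toReal ≤ (Λ + 1) * t := by
  rcases eq_or_ne t 0 with rfl | ht
  · simp [h.zero x hx]
  have ht0 : 0 < t := pos_iff_ne_zero.2 ht
  -- The extra `1` gives a strict inequality, so the difference quotient at `t / m` exceeds `-(Λ +
  -- 1)` for large `m`. Supermultiplicativity of `P^t(x,x)` and Bernoulli's inequality carry this
  -- bound up to time `t`.
  have hlt : -(Λ + 1) < q x x := by linarith [h.neg_diag_le x hx]
  have hev := (h.tendsto x hx x).eventually (lt_mem_nhds hlt)
  have hseq : Tendsto (fun m : ℕ => t / (m : ℝ≥0)) atTop (𝓝[>] 0) := by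
    refine tendsto_nhdsWithin_iff.2 ⟨tendsto_const_div_atTop_nhds_zero_nat t, ?_⟩
    filter_upwards [eventually_gt_atTop 0] with m hm
    have : (0 : ℝ≥0) < m := by exact_mod_cast hm
    exact div_pos ht0 this
  have hsmall : Tendsto (fun m : ℕ => -((Λ + 1) * t) / (m : ℝ)) atTop (𝓝 0) :=
    tendsto_const_div_atTop_nhds_zero_nat _
  obtain ⟨m, hm, hm0, hm1⟩ := ((hseq.eventually hev).and ((eventually_gt_atTop 0).and
    (hsmall.eventually (lt_mem_nhds (show (-1 : ℝ) < 0 by norm_num))))).exists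
  have hmR : (0 : ℝ) < m := by exact_mod_cast hm0
  have hmN : (m : ℝ≥0) ≠ 0 := by exact_mod_cast hm0.ne'
  have htm : (0 : ℝ) < ((t / (m : ℝ≥0) : ℝ≥0) : ℝ) := by
    push_cast
    exact div_pos (by exact_mod_cast ht0) hmR
  rw [lt_div_iff₀ htm] at hm
  have h1 : 1 + -((Λ + 1) * t) / m ≤ (P (t / m) x x).toReal := by
    have : (PMF.pure x x).toReal = 1 := by simp
    rw [this] at hm
    push_cast at hm
    have e : -((Λ + 1) * t) / (m : ℝ) = -(Λ + 1) * (t / m) := by ring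
    rw [e]
    linarith
  have h2 := h.pow_le_apply_self hx (t / m) m
  rw [mul_div_cancel₀ t hmN] at h2
  have h3 := one_add_mul_le_pow (show (-2 : ℝ) ≤ -((Λ + 1) * t) / m by linarith) m
  rw [mul_div_cancel₀ _ hmR.ne'] at h3
  have h4 := pow_le_pow_left₀ (by linarith) h1 m
  linarith

theorem summable_mul (h : IsBoundedJumpSemigroup P S q Λ) {x : α} (hx : x ∈ S) {f : α → ℝ} {M : ℝ}
    (h0 : ∀ y, 0 ≤ f y) (hM : ∀ y, f y ≤ M) : Summable fun y => q x y * f y := by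
  refine Summable.of_norm_bounded ((h.summable x hx).norm.mul_right M) fun y => ?_
  rw [norm_mul, Real.norm_of_nonneg (h0 y)]
  exact mul_le_mul_of_nonneg_left (hM y) (norm_nonneg _)

/-- Fatou's argument: finitely many entries nearly exhaust the sum, and the discarded terms are
nonnegative. Applied to `M - f`, it yields the opposite bound, by conservativity. -/
theorem eventually_lt_div (h : IsBoundedJumpSemigroup P S q Λ) {x : α} (hx : x ∈ S) {f : α → ℝ}
    {M : ℝ} (h0 : ∀ y, 0 ≤ f y) (hM : ∀ y, f y ≤ M) {r : ℝ} (hr : r < ∑' y, q x y * f y) :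
    ∀ᶠ t : ℝ≥0 in 𝓝[>] 0, r < (expectation (P t x) f - f x) / t := by
  classical
  have hF := (h.summable_mul hx h0 hM).hasSum.eventually (lt_mem_nhds hr)
  obtain ⟨F, hF, hxF⟩ := (hF.and (eventually_ge_atTop {x})).exists
  have hxF : x ∈ F := by simpa using hxF
  have hlim : Tendsto (fun t : ℝ≥0 => ∑ y ∈ F,
      ((P t x y).toReal - (PMF.pure x y).toReal) / (t : ℝ) * f y) (𝓝[>] 0)
      (𝓝 (∑ y ∈ F, q x y * f y)) :=
    tendsto_finsetSum _ fun y _ => (h.tendsto x hx y).mul_const _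
  filter_upwards [hlim.eventually (lt_mem_nhds hF), self_mem_nhdsWithin] with t ht ht0
  have ht0 : (0 : ℝ) < t := by exact_mod_cast ht0
  refine ht.trans_le ?_
  rw [le_div_iff₀ ht0, Finset.sum_mul]
  have e : ∀ y, ((P t x y).toReal - (PMF.pure x y).toReal) / (t : ℝ) * f y * t
      = (P t x y).toReal * f y - (PMF.pure x y).toReal * f y := by
    intro y
    field_simp
  simp_rw [e]
  rw [Finset.sum_sub_distrib]
  have h1 : ∑ y ∈ F, (PMF.pure x y).toReal * f y = f x := by
    rw [Finset.sum_eq_single_of_mem x hxF]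
    · simp
    · intro y _ hy
      simp [PMF.pure_apply, hy]
  rw [h1]
  have h2 : ∑ y ∈ F, (P t x y).toReal * f y ≤ expectation (P t x) f :=
    (summable_toReal_mul _ fun y => by rw [abs_of_nonneg (h0 y)]; exact hM y).sum_le_tsum _
      fun y _ => mul_nonneg ENNReal.toReal_nonneg (h0 y)
  linarith

/-- The rate matrix is the generator on bounded functions. -/
theorem tendsto_expectation (h : IsBoundedJumpSemigroup P S q Λ) {x : α} (hx : x ∈ S) {f : α → ℝ}
    {M : ℝ} (h0 : ∀ y, 0 ≤ f y) (hM : ∀ y, f y ≤ M) :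
    Tendsto (fun t : ℝ≥0 => (expectation (P t x) f - f x) / t) (𝓝[>] 0)
      (𝓝 (∑' y, q x y * f y)) := by
  refine tendsto_order.2 ⟨fun r hr => h.eventually_lt_div hx h0 hM hr, fun r hr => ?_⟩
  have hq : ∑' y, q x y * (M - f y) = -∑' y, q x y * f y := by
    simp_rw [mul_sub]
    rw [((h.summable x hx).mul_right M).tsum_sub (h.summable_mul hx h0 hM), tsum_mul_right,
      h.conservative x hx]
    ring
  have hE : ∀ t, expectation (P t x) (fun y => M - f y) = M - expectation (P t x) f := by
    intro t
    simp only [expectation, mul_sub]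
    rw [Summable.tsum_sub (summable_toReal_mul _ fun _ => le_refl |M|)
      (summable_toReal_mul _ fun y => by rw [abs_of_nonneg (h0 y)]; exact hM y), tsum_mul_right,
      tsum_toReal_eq_one, one_mul]
  have h1 := h.eventually_lt_div (f := fun y => M - f y) (M := M) hx
    (fun y => by linarith [hM y]) (fun y => by linarith [h0 y]) (r := -r) (by rw [hq]; linarith)
  filter_upwards [h1] with t ht
  rw [hE] at ht
  have : (M - expectation (P t x) f - (M - f x)) / (t : ℝ)
      = -((expectation (P t x) f - f x) / t) := by ring
  rw [this] at ht
  linarith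

theorem expectation_add (h : IsBoundedJumpSemigroup P S q Λ) (x : α) {f : α → ℝ} {M : ℝ}
    (h0 : ∀ y, 0 ≤ f y) (hM : ∀ y, f y ≤ M) (s t : ℝ≥0) :
    expectation (P (s + t) x) f - expectation (P s x) f
      = ∑' z, (P s x z).toReal * (expectation (P t z) f - f z) := by
  rw [h.add, expectation_bind _ _ h0 hM]
  simp_rw [mul_sub]
  rw [Summable.tsum_sub]
  · rfl
  · exact summable_toReal_mul (M := M) _ fun z => by
      rw [abs_of_nonneg (expectation_nonneg _ h0)]
      exact expectation_le _ h0 hM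
  · exact summable_toReal_mul (M := M) _ fun z => by
      rw [abs_of_nonneg (h0 z)]
      exact hM z

theorem norm_term_le (h : IsBoundedJumpSemigroup P S q Λ) (x : α) {f : α → ℝ} {M : ℝ}
    (h0 : ∀ y, 0 ≤ f y) (hM : ∀ y, f y ≤ M) (s t : ℝ≥0) (z : α) :
    ‖(P s x z).toReal * (expectation (P t z) f - f z)‖
      ≤ (P s x z).toReal * (M * ((Λ + 1) * t)) := by
  by_cases hz : z ∈ S
  · rw [norm_mul, Real.norm_of_nonneg ENNReal.toReal_nonneg]
    refine mul_le_mul_of_nonneg_left ?_ ENNReal.toReal_nonneg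
    refine (abs_expectation_sub_le _ z h0 hM).trans ?_
    exact mul_le_mul_of_nonneg_left (h.one_sub_apply_self_le hz t) ((h0 z).trans (hM z))
  · have : P s x z = 0 := by
      by_contra hne
      exact hz (h.support_subset s x ((PMF.mem_support_iff _ _).2 hne))
    simp [this]

theorem abs_expectation_add_sub_le (h : IsBoundedJumpSemigroup P S q Λ) (x : α) {f : α → ℝ}
    {M : ℝ} (h0 : ∀ y, 0 ≤ f y) (hM : ∀ y, f y ≤ M) (s t : ℝ≥0) :
    |expectation (P (s + t) x) f - expectation (P s x) f| ≤ M * (Λ + 1) * t := by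
  rw [h.expectation_add x h0 hM]
  have hs : HasSum (fun z => (P s x z).toReal * (M * ((Λ + 1) * t))) (M * (Λ + 1) * t) := by
    have h1 : Summable fun z => (P s x z).toReal :=
      ENNReal.summable_toReal (P s x).tsum_coe_ne_top
    have := h1.hasSum.mul_right (M * ((Λ + 1) * (t : ℝ)))
    rw [tsum_toReal_eq_one, one_mul] at this
    rwa [mul_assoc M]
  exact tsum_of_norm_bounded hs fun z => h.norm_term_le x h0 hM s t z

/-- The right derivative of `t ↦ P^t f(x)` is `P^t 𝒢f(x)`. -/
theorem tendsto_right_slope (h : IsBoundedJumpSemigroup P S q Λ) (x : α) {f : α → ℝ}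
    {M : ℝ} (h0 : ∀ y, 0 ≤ f y) (hM : ∀ y, f y ≤ M) (s : ℝ≥0) :
    Tendsto (fun t : ℝ≥0 => (expectation (P (s + t) x) f - expectation (P s x) f) / t) (𝓝[>] 0)
      (𝓝 (∑' z, (P s x z).toReal * ∑' y, q z y * f y)) := by
  simp_rw [h.expectation_add x h0 hM, ← tsum_div_const, mul_div_assoc]
  -- The exit estimate, uniform over `S`, supplies the dominating function.
  refine tendsto_tsum_of_dominated_convergence (bound := fun z => (P s x z).toReal * (M * (Λ + 1)))
    ((ENNReal.summable_toReal (P s x).tsum_coe_ne_top).mul_right _) (fun z => ?_) ?_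
  · by_cases hz : z ∈ S
    · exact (h.tendsto_expectation hz h0 hM).const_mul _
    · have : P s x z = 0 := by
        by_contra hne
        exact hz (h.support_subset s x ((PMF.mem_support_iff _ _).2 hne))
      simp [this]
  · filter_upwards [self_mem_nhdsWithin] with t ht z
    have ht0 : (0 : ℝ) < t := by exact_mod_cast ht
    have h1 := h.norm_term_le x h0 hM s t z
    rw [← mul_div_assoc, norm_div, Real.norm_of_nonneg ht0.le, div_le_iff₀ ht0]
    linarith

/-- A drift condition `𝒢f ≤ c f` makes `P^t f` grow at most like `e^{ct}`. -/
theorem expectation_le_exp_mul (h : IsBoundedJumpSemigroup P S q Λ) {x : α} (hx : x ∈ S)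
    {f : α → ℝ} {M c : ℝ} (h0 : ∀ y, 0 ≤ f y) (hM : ∀ y, f y ≤ M)
    (hf : ∀ z ∈ S, ∑' y, q z y * f y ≤ c * f z) (t : ℝ≥0) :
    expectation (P t x) f ≤ f x * Real.exp (c * t) := by
  -- Grönwall's inequality is used on the real line; truncating time at zero keeps `g` Lipschitz
  -- there. Only right difference quotients are required.
  set g : ℝ → ℝ := fun s => expectation (P s.toNNReal x) f with hg
  set g' : ℝ → ℝ := fun s => ∑' z, (P s.toNNReal x z).toReal * ∑' y, q z y * f y with hg'
  have hB : 0 ≤ M * (Λ + 1) := by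
    have := (abs_nonneg _).trans (h.abs_expectation_add_sub_le x h0 hM 0 1)
    simpa using this
  have hlip : ∀ a b : ℝ, a ≤ b → |g b - g a| ≤ M * (Λ + 1) * |b - a| := by
    intro a b hab
    have e : b.toNNReal = a.toNNReal + (b.toNNReal - a.toNNReal) :=
      (add_tsub_cancel_of_le (Real.toNNReal_le_toNNReal hab)).symm
    simp only [hg]
    rw [e]
    refine (h.abs_expectation_add_sub_le x h0 hM _ _).trans ?_
    refine mul_le_mul_of_nonneg_left ?_ hB
    rw [NNReal.coe_sub (Real.toNNReal_le_toNNReal hab), abs_of_nonneg (sub_nonneg.2 hab)]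
    simp only [Real.coe_toNNReal']
    rcases le_total a 0 with ha | ha <;> rcases le_total b 0 with hb | hb <;>
      simp [ha, hb] <;> linarith
  have hcont : Continuous g := by
    refine (LipschitzWith.of_dist_le_mul (K := ⟨M * (Λ + 1), hB⟩) fun a b => ?_).continuous
    rw [Real.dist_eq, Real.dist_eq]
    rcases le_total a b with hab | hab
    · rw [abs_sub_comm, abs_sub_comm a b]
      exact hlip a b hab
    · exact hlip b a hab
  have hderiv : ∀ s ∈ Set.Ico (0 : ℝ) t, ∀ r, g' s < r →
      ∃ᶠ z in 𝓝[>] s, (z - s)⁻¹ * (g z - g s) < r := by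
    intro s hs r hr
    have hshift : Tendsto (fun z : ℝ => (z - s).toNNReal) (𝓝[>] s) (𝓝[>] 0) := by
      refine tendsto_nhdsWithin_iff.2 ⟨?_, ?_⟩
      · have : Tendsto (fun z : ℝ => (z - s).toNNReal) (𝓝 s) (𝓝 (s - s).toNNReal) :=
          (continuous_real_toNNReal.comp (continuous_id.sub continuous_const)).tendsto s
        rw [sub_self, Real.toNNReal_zero] at this
        exact this.mono_left nhdsWithin_le_nhds
      · filter_upwards [self_mem_nhdsWithin] with z hz
        exact Real.toNNReal_pos.2 (sub_pos.2 hz)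
    have h1 := ((h.tendsto_right_slope x h0 hM s.toNNReal).comp hshift).eventually
      (gt_mem_nhds hr)
    refine Eventually.frequently ?_
    filter_upwards [h1, self_mem_nhdsWithin] with z hz hsz
    have hsz' : 0 ≤ z - s := (sub_pos.2 hsz).le
    have e : s.toNNReal + (z - s).toNNReal = z.toNNReal := by
      rw [← Real.toNNReal_add hs.1 hsz']
      ring_nf
    simp only [Function.comp_apply, e, Real.coe_toNNReal _ hsz'] at hz
    rwa [mul_comm, ← div_eq_mul_inv]
  have hbound : ∀ s ∈ Set.Ico (0 : ℝ) t, g' s ≤ c * g s + 0 := by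
    intro s _
    simp only [hg, hg', expectation, add_zero]
    rw [← tsum_mul_left]
    have hs2 := (summable_toReal_mul (P s.toNNReal x)
      fun y => by rw [abs_of_nonneg (h0 y)]; exact hM y).mul_left c
    have hle : ∀ z, (P s.toNNReal x z).toReal * ∑' y, q z y * f y
        ≤ c * ((P s.toNNReal x z).toReal * f z) := by
      intro z
      by_cases hz : z ∈ S
      · rw [mul_left_comm]
        exact mul_le_mul_of_nonneg_left (hf z hz) ENNReal.toReal_nonneg
      · have : P s.toNNReal x z = 0 := by
          by_contra hne
          exact hz (h.support_subset _ x ((PMF.mem_support_iff _ _).2 hne))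
        simp [this]
    have hs1 : Summable fun z => (P s.toNNReal x z).toReal * ∑' y, q z y * f y := by
      refine Summable.of_norm_bounded (g := fun z => (P s.toNNReal x z).toReal * (M * (Λ + 1)))
        ((ENNReal.summable_toReal (P s.toNNReal x).tsum_coe_ne_top).mul_right _) fun z => ?_
      by_cases hz : z ∈ S
      · rw [norm_mul, Real.norm_of_nonneg ENNReal.toReal_nonneg]
        refine mul_le_mul_of_nonneg_left ?_ ENNReal.toReal_nonneg
        refine le_of_tendsto (h.tendsto_expectation hz h0 hM).norm ?_
        filter_upwards [self_mem_nhdsWithin] with u hu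
        have hu0 : (0 : ℝ) < u := by exact_mod_cast hu
        rw [norm_div, Real.norm_of_nonneg hu0.le, div_le_iff₀ hu0, mul_assoc]
        exact (abs_expectation_sub_le _ z h0 hM).trans
          (mul_le_mul_of_nonneg_left (h.one_sub_apply_self_le hz u) ((h0 z).trans (hM z)))
      · have : P s.toNNReal x z = 0 := by
          by_contra hne
          exact hz (h.support_subset _ x ((PMF.mem_support_iff _ _).2 hne))
        simp [this]
    exact hs1.tsum_le_tsum hle hs2
  have hstart : g 0 ≤ f x := by
    simp only [hg, Real.toNNReal_zero, h.zero x hx, expectation_pure, le_refl]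
  have := le_gronwallBound_of_liminf_deriv_right_le hcont.continuousOn hderiv hstart hbound t
    ⟨t.2, le_rfl⟩
  simpa [hg, gronwallBound_ε0] using this

end IsBoundedJumpSemigroup

/-! ### Draining never increases the norm. -/

namespace Network

variable {N J : ℕ}

theorem l1_transfer_le (net : Network N J) (i : Fin N) (k : ℕ) (x : State N) (hk : k ≤ x i) :
    l1 (net.transfer i k x) ≤ l1 x := by
  -- Here `k ≤ x i` makes the truncated subtraction exact.
  have h1 : ∑ j, (x j - if j = i then k else 0) + k = l1 x := by
    rw [l1, ← Finset.add_sum_erase _ _ (Finset.mem_univ i),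
      ← Finset.add_sum_erase _ x (Finset.mem_univ i)]
    have : ∑ j ∈ Finset.univ.erase i, (x j - if j = i then k else 0)
        = ∑ j ∈ Finset.univ.erase i, x j :=
      Finset.sum_congr rfl fun j hj => by simp [Finset.ne_of_mem_erase hj]
    rw [this, if_pos rfl]
    omega
  have h2 : ∑ j, (if net.next i = some j then k else 0) ≤ k := by
    cases hn : net.next i with
    | none => simp
    | some j => simp
  have h3 : l1 (net.transfer i k x) = ∑ j, (x j - if j = i then k else 0)
      + ∑ j, (if net.next i = some j then k else 0) := by
    rw [← Finset.sum_add_distrib]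
    rfl
  omega

theorem DrainsTo.l1_le {net : Network N J} {Ξ : Fin N → Set (State N)} {x y : State N}
    (h : net.DrainsTo Ξ x y) : l1 y ≤ l1 x := by
  induction h with
  | refl => exact le_rfl
  | tail _ hstep ih =>
    obtain ⟨i, -, -, rfl⟩ := hstep
    exact (net.l1_transfer_le i _ _ le_rfl).trans ih

end Network

/-! ### Drift of the norm and exponential tails for networks. -/

namespace StationaryPolicy

variable {N J : ℕ} {net : Network N J}

theorem alloc_le_one (pol : StationaryPolicy net) (x : State N) (i : Fin N) :
    pol.alloc x i ≤ 1 :=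
  (Finset.single_le_sum (f := fun k => pol.alloc x k) (fun k _ => pol.alloc_nonneg x k)
    (Finset.mem_filter.2 ⟨Finset.mem_univ i, (rfl : net.station i = net.station i)⟩)).trans (pol.alloc_le x (net.station i))

theorem eventRate_nonneg (pol : StationaryPolicy net) (x : State N) (e : NetworkEvent N) :
    0 ≤ pol.eventRate x e := by
  cases e with
  | arrival i => exact NNReal.coe_nonneg _
  | completion i => exact mul_nonneg ENNReal.toReal_nonneg (pol.alloc_nonneg x i)
  | virtual i =>
    exact mul_nonneg ENNReal.toReal_nonneg (sub_nonneg.2 (pol.alloc_le_one x i))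

theorem hasSum_eventGen (pol : StationaryPolicy net) (x : State N) (e : NetworkEvent N)
    {f : State N → ℝ} {M : ℝ} (hf : ∀ y, |f y| ≤ M) :
    HasSum (fun y => pol.eventGen x y e * f y)
      (pol.eventRate x e * (expectation (pol.jump e x) f - f x)) := by
  have h1 := (summable_toReal_mul (pol.jump e x) hf).hasSum
  have h2 := hasSum_ite_eq x (f x)
  refine ((h1.sub h2).mul_left (pol.eventRate x e)).congr_fun ?_
  intro y
  by_cases hy : y = x
  · subst hy
    simp [eventGen]
    ring
  · simp [eventGen, hy, Ne.symm hy]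
    ring

/-- The rate matrix is a finite combination of differences of probability laws, hence summable
against every bounded function. Taking `f = 1` gives conservativity. -/
theorem hasSum_generator (pol : StationaryPolicy net) (x : State N)
    {f : State N → ℝ} {M : ℝ} (hf : ∀ y, |f y| ≤ M) :
    HasSum (fun y => pol.generator x y * f y)
      (∑ i, (pol.eventRate x (.arrival i) * (expectation (pol.jump (.arrival i) x) f - f x)
        + pol.eventRate x (.completion i) * (expectation (pol.jump (.completion i) x) f - f x)
        + pol.eventRate x (.virtual i) * (expectation (pol.jump (.virtual i) x) f - f x))) := by
  simp only [generator, Finset.sum_mul, add_mul]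
  exact hasSum_sum fun i _ => ((pol.hasSum_eventGen x _ hf).add
    (pol.hasSum_eventGen x _ hf)).add (pol.hasSum_eventGen x _ hf)

theorem expectation_one {α : Type*} (p : PMF α) : expectation p (fun _ => 1) = 1 := by
  simp [expectation, tsum_toReal_eq_one]

theorem hasSum_generator_zero (pol : StationaryPolicy net) (x : State N) :
    HasSum (pol.generator x) 0 := by
  simpa [expectation_one] using pol.hasSum_generator x (f := fun _ => 1) (M := 1) (by simp)

theorem neg_eventGen_self_le (pol : StationaryPolicy net) (x : State N) (e : NetworkEvent N) :
    -pol.eventGen x x e ≤ pol.eventRate x e := by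
  have h1 := pol.eventRate_nonneg x e
  have h2 : 0 ≤ pol.eventRate x e * (pol.jump e x x).toReal :=
    mul_nonneg h1 ENNReal.toReal_nonneg
  simp only [eventGen, if_true]
  linarith

/-- Real and virtual completions at a buffer have total rate `μ_i`, whatever the allocation, so the
bound is uniform in the state. -/
theorem neg_generator_self_le (pol : StationaryPolicy net) (x : State N) :
    -pol.generator x x ≤ ∑ i, ((net.arrivalRate i : ℝ) + (net.serviceRate i).toReal) := by
  rw [generator, ← Finset.sum_neg_distrib]
  refine Finset.sum_le_sum fun i _ => ?_
  have h1 := pol.neg_eventGen_self_le x (.arrival i)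
  have h2 := pol.neg_eventGen_self_le x (.completion i)
  have h3 := pol.neg_eventGen_self_le x (.virtual i)
  simp only [eventRate] at h1 h2 h3
  linarith

/-- The truncated exponential of the norm. -/
noncomputable def expTrunc (M : ℝ) (y : State N) : ℝ := min (Real.exp (l1 y)) M

theorem expTrunc_nonneg {M : ℝ} (hM : 0 ≤ M) (y : State N) : 0 ≤ expTrunc M y :=
  le_min (Real.exp_pos _).le hM

theorem expTrunc_mono (M : ℝ) {x y : State N} (h : l1 x ≤ l1 y) : expTrunc M x ≤ expTrunc M y :=
  min_le_min_right _ (Real.exp_le_exp.2 (by exact_mod_cast h))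

theorem expTrunc_le_of_le_add_one {M : ℝ} (hM : 0 ≤ M) {x y : State N} (h : l1 y ≤ l1 x + 1) :
    expTrunc M y ≤ Real.exp 1 * expTrunc M x := by
  have h1 : (1 : ℝ) ≤ Real.exp 1 := Real.one_le_exp zero_le_one
  have h2 : (l1 y : ℝ) ≤ 1 + l1 x := by
    have : (l1 y : ℝ) ≤ ((l1 x + 1 : ℕ) : ℝ) := by exact_mod_cast h
    push_cast at this
    linarith
  rw [expTrunc, expTrunc, mul_min_of_nonneg _ _ (Real.exp_pos _).le, ← Real.exp_add]
  exact min_le_min (Real.exp_le_exp.2 h2) (le_mul_of_one_le_left hM h1)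

/-- Only arrivals increase the norm, so the truncated exponential satisfies a linear drift
condition. -/
theorem tsum_generator_mul_expTrunc_le (pol : StationaryPolicy net) {M : ℝ} (hM : 0 ≤ M)
    {x : State N} (hx : x ∈ pol.rest) :
    ∑' y, pol.generator x y * expTrunc M y
      ≤ (∑ i, (net.arrivalRate i : ℝ) * (Real.exp 1 - 1)) * expTrunc M x := by
  have habs : ∀ y : State N, |expTrunc M y| ≤ M := fun y => by
    rw [abs_of_nonneg (expTrunc_nonneg hM y)]
    exact min_le_right _ _
  rw [(pol.hasSum_generator x habs).tsum_eq, Finset.sum_mul]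
  refine Finset.sum_le_sum fun i _ => ?_
  have harr : expectation (pol.jump (.arrival i) x) (expTrunc M)
      ≤ Real.exp 1 * expTrunc M x := by
    refine expectation_le_of_support _ habs fun y hy => expTrunc_le_of_le_add_one hM ?_
    refine (pol.jump_support (.arrival i) x hx trivial y hy).2.l1_le.trans (le_of_eq ?_)
    simp [NetworkEvent.effect, l1, Finset.sum_add_distrib]
  have hcomp : pol.eventRate x (.completion i)
      * (expectation (pol.jump (.completion i) x) (expTrunc M) - expTrunc M x) ≤ 0 := by
    -- At an empty buffer the jump law is unconstrained, but the completion rate vanishes.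
    rcases Nat.eq_zero_or_pos (x i) with h0 | hpos
    · simp [eventRate, pol.alloc_empty x i h0]
    · refine mul_nonpos_of_nonneg_of_nonpos (pol.eventRate_nonneg x _) (sub_nonpos.2 ?_)
      refine expectation_le_of_support _ habs fun y hy => expTrunc_mono M ?_
      exact (pol.jump_support (.completion i) x hx hpos y hy).2.l1_le.trans
        (net.l1_transfer_le i 1 x hpos)
  have hvirt : pol.eventRate x (.virtual i)
      * (expectation (pol.jump (.virtual i) x) (expTrunc M) - expTrunc M x) ≤ 0 := by
    refine mul_nonpos_of_nonneg_of_nonpos (pol.eventRate_nonneg x _) (sub_nonpos.2 ?_)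
    refine expectation_le_of_support _ habs fun y hy => expTrunc_mono M ?_
    exact (pol.jump_support (.virtual i) x hx trivial y hy).2.l1_le
  have harr' : (net.arrivalRate i : ℝ)
      * (expectation (pol.jump (.arrival i) x) (expTrunc M) - expTrunc M x)
      ≤ net.arrivalRate i * ((Real.exp 1 - 1) * expTrunc M x) :=
    mul_le_mul_of_nonneg_left (by linarith) (NNReal.coe_nonneg _)
  have : pol.eventRate x (.arrival i) = net.arrivalRate i := rfl
  rw [this]
  linarith

variable {pol : StationaryPolicy net} {P : ℝ≥0 → State N → PMF (State N)}

/-- Since `t = t + 0`, the law `P^t` ends with a draining by `start`, which lands in a rest state.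
-/
theorem IsTransitionSemigroup.support_subset_rest (hP : pol.IsTransitionSemigroup P) (t : ℝ≥0)
    (x : State N) : (P t x).support ⊆ pol.rest := by
  intro y hy
  rw [← add_zero t, hP.add] at hy
  obtain ⟨z, -, hz⟩ := (PMF.mem_support_bind_iff _ _ _).1 hy
  rw [hP.zero] at hz
  exact (pol.start_support z y hz).1

theorem IsTransitionSemigroup.isBoundedJumpSemigroup (hP : pol.IsTransitionSemigroup P) :
    IsBoundedJumpSemigroup P pol.rest pol.generator
      (∑ i, ((net.arrivalRate i : ℝ) + (net.serviceRate i).toReal)) where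
  zero x hx := by rw [hP.zero, pol.start_rest x hx]
  add := hP.add
  support_subset := hP.support_subset_rest
  summable x _ := (pol.hasSum_generator_zero x).summable
  conservative x _ := (pol.hasSum_generator_zero x).tsum_eq
  neg_diag_le x _ := pol.neg_generator_self_le x
  tendsto x hx y := by
    have e : (PMF.pure x y).toReal = if x = y then 1 else 0 := by
      rw [PMF.pure_apply]
      by_cases h : x = y
      · simp [h]
      · simp [h, Ne.symm h]
    rw [e]
    exact hP.rates x hx y

/-- The exponential moment of the norm grows at most exponentially in time. -/
theorem IsTransitionSemigroup.tsum_mul_exp_le (hP : pol.IsTransitionSemigroup P) {x : State N}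
    (hx : x ∈ pol.rest) (t : ℝ≥0) :
    ∑' y, P t x y * ENNReal.ofReal (Real.exp (l1 y)) ≤ ENNReal.ofReal (Real.exp (l1 x)
      * Real.exp ((∑ i, (net.arrivalRate i : ℝ) * (Real.exp 1 - 1)) * t)) := by
  rw [ENNReal.tsum_eq_iSup_sum]
  refine iSup_le fun F => ?_
  -- A truncation level that is inactive on `F`; the resulting bound does not depend on it.
  obtain ⟨M, hM⟩ := (F.image fun y => Real.exp (l1 y : ℝ)).bddAbove
  have hM0 : (0 : ℝ) ≤ max M 0 := le_max_right _ _
  have hFM : ∀ y ∈ F, Real.exp (l1 y) = expTrunc (max M 0) y := fun y hy =>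
    (min_eq_left ((hM (Finset.mem_coe.2 (Finset.mem_image_of_mem _ hy))).trans
      (le_max_left _ _))).symm
  have hle : ∀ y : State N, expTrunc (max M 0) y ≤ max M 0 := fun y => min_le_right _ _
  calc ∑ y ∈ F, P t x y * ENNReal.ofReal (Real.exp (l1 y))
      = ∑ y ∈ F, P t x y * ENNReal.ofReal (expTrunc (max M 0) y) :=
        Finset.sum_congr rfl fun y hy => by rw [hFM y hy]
    _ ≤ ∑' y, P t x y * ENNReal.ofReal (expTrunc (max M 0) y) := ENNReal.sum_le_tsum F
    _ = ENNReal.ofReal (expectation (P t x) (expTrunc (max M 0))) :=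
        (ofReal_expectation _ (expTrunc_nonneg hM0) hle).symm
    _ ≤ _ := by
        refine ENNReal.ofReal_le_ofReal ?_
        refine (hP.isBoundedJumpSemigroup.expectation_le_exp_mul hx (expTrunc_nonneg hM0) hle
          (fun z hz => pol.tsum_generator_mul_expTrunc_le hM0 hz) t).trans ?_
        exact mul_le_mul_of_nonneg_right (min_le_left _ _) (Real.exp_pos _).le

/-- A rest state is needed already for `n = 0`: `P 0 x` is `start x`, whereas `stepLaw` starts from
a point mass. -/
theorem IsTransitionSemigroup.stepLaw_one (hP : pol.IsTransitionSemigroup P) {x : State N}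
    (hx : x ∈ pol.rest) (n : ℕ) : stepLaw (P 1) n x = P n x := by
  induction n with
  | zero => rw [Nat.cast_zero, hP.zero, pol.start_rest x hx, stepLaw]
  | succ n ih => rw [stepLaw, ih, Nat.cast_succ, hP.add]

/-- Equilibria of exponentially ergodic Markovian multiclass networks have exponential tails. -/
theorem IsTransitionSemigroup.hasExponentialTail (hP : pol.IsTransitionSemigroup P)
    (hE : IsExponentiallyErgodic P) {π : PMF (State N)} (hπ : IsInvariantLawFlow P π) :
    HasExponentialTail π := by
  obtain ⟨π₀, -, θ, hθ, h⟩ := hE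
  have hcast : Tendsto (fun n : ℕ => (n : ℝ≥0)) atTop atTop := tendsto_natCast_atTop_atTop
  obtain rfl : π = π₀ := eq_of_bind_eq_of_tendsto (fun n : ℕ => P n) π₀ π
    (fun n => hπ n) fun x y =>
      (tendsto_of_tendsto_exp_mul hθ.le (fun t : ℝ≥0 => t.2) (h x y)).comp hcast
  obtain ⟨a, ha⟩ := π.support_nonempty
  -- Invariance at time `0` already confines `π` to the rest states.
  have har : a ∈ pol.rest := by
    have ha' := ha
    rw [← hπ 0] at ha'
    obtain ⟨z, -, hz⟩ := (PMF.mem_support_bind_iff _ _ _).1 ha'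
    exact hP.support_subset_rest 0 z hz
  refine hasExponentialTail_of_moment_growth (P 1) a π ((PMF.mem_support_iff _ _).1 ha) hθ
    (fun y => ?_) one_pos (Real.exp_pos (l1 a)).le
    (Real.exp_pos (∑ i, (net.arrivalRate i : ℝ) * (Real.exp 1 - 1))) fun n => ?_
  · simp_rw [hP.stepLaw_one har]
    exact (h a y).comp hcast
  · simp_rw [hP.stepLaw_one har, one_mul]
    have := hP.tsum_mul_exp_le har n
    rwa [NNReal.coe_natCast, mul_comm (∑ i, _) (n : ℝ), Real.exp_nat_mul] at this

end StationaryPolicy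

theorem theorem3 (N : ℕ) :
    (∀ P : State N → PMF (State N),
      IsSkipFree P → IsZeroIrreducible P → IsGeometricallyErgodic P →
        ∀ π : PMF (State N), IsInvariantLaw P π → HasExponentialTail π) ∧
    (∀ (J : ℕ) (net : Network N J) (pol : StationaryPolicy net)
      (P : ℝ≥0 → State N → PMF (State N)),
      (∀ i, net.next i = none → net.serviceRate i < ∞) →
      pol.IsTransitionSemigroup P → IsExponentiallyErgodic P →
        ∀ π : PMF (State N), IsInvariantLawFlow P π → HasExponentialTail π) :=
  ⟨fun _ hP _ hE _ hπ => hP.hasExponentialTail hE hπ,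
    fun _ _ _ _ _ hP hE _ hπ => hP.hasExponentialTail hE hπ⟩
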